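/- Let $k\ge 1$ be a fixed integer. The equation $$\beta\,(1-\log\beta+\log k)\;=\;k-1$$ (with the convention $0\log 0=0$) has a unique solution $\beta=\beta_k$ in $[0,k-1]$; moreover $\beta_1=0$, and $\beta_k>0$ for $k\ge 2$. Fix a real constant $C>1$. For each integer $n\ge 1$ let $(x_{1,n},x_{2,n},\dots,x_{k,n})$ be a random vector, uniformly distributed on the set of integer vectors in $[1,C^n]^k$, and suppose that these random vectors are independent for different $n$. Let $\Omega(m)$ denote the number of prime factors of the positive integer $m$, counted with multiplicity. Then with probability one, $$\liminf_{n\to\infty}\frac{\Omega(x_{1,n}\,x_{2,n}\cdots x_{k,n})}{\log n}\;=\;\beta_k .$$ -/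

import Mathlib

open MeasureTheory ProbabilityTheory Filter
open scoped ArithmeticFunction.Omega

/-- `β ∈ [0, k - 1]` solves `β (1 - log β + log k) = k - 1`. At `β = 0` the left-hand side is `0`,
in accordance with the usual convention `0 log 0 = 0`. -/
def IsBeta (k : ℕ) (β : ℝ) : Prop :=
  β ∈ Set.Icc (0 : ℝ) ((k : ℝ) - 1) ∧ β * (1 - Real.log β + Real.log k) = (k : ℝ) - 1

/-- The integer vectors in `[1, X] ^ k`. -/
def integerBox (k : ℕ) (X : ℝ) : Set (Fin k → ℕ) :=
  {v | ∀ i, (v i : ℝ) ∈ Set.Icc (1 : ℝ) X}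

/-!
For `x` uniform in `[1, C ^ n]`, `Ω(x)` behaves like a Poisson variable of parameter `log n`, so the
number of prime factors of a product of `k` such integers behaves like a Poisson variable of
parameter `k log n`. Hence the probability that it is at most `c log n`, for `0 < c < k`, is
`n ^ (-I(c) + o(1))` with `I(c) = k - c + c log (c / k) = k - c (1 - log c + log k)`. The function
`c (1 - log c + log k)` is strictly increasing on `[0, k]`, so `I(c) = 1` exactly at `c = β`, and the
two Borel–Cantelli lemmas give the almost sure value `β` of the lower limit. Two tail estimates are
needed.

*Upper bound* (`exists_card_boxOmegaLE_div_le`). By Chernoff's bound it suffices to know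
`∑_{m ≤ N} z ^ Ω(m) = O(N (log N) ^ (z - 1))` for `z ≤ 1`, and to take `z = c / k`. The identity
`log = Λ * 1` and Chebyshev's bound `ψ(x) = O(x)` reduce this sum to the logarithmic one,
`∑_{m ≤ N} z ^ Ω(m) / m` (`sum_powOmegaHom_mul_log_le`). With `s = 1 + 1 / log N` the latter is at most
`e ∑ z ^ Ω(m) m ^ (-s) ≤ e ζ(s) ^ z ≤ e (1 + log N) ^ z`, by comparison of Euler products
(`tsum_powOmegaHom_mul_rpow_le`).

*Lower bound* (`eventually_rpow_neg_mul_le_card`). With `a = c / k` and `r + 1 ≈ a log n`, the integers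
`m = p d ≤ M = ⌊C ^ n⌋` are counted, where `d ≤ N ^ r ≤ √M` has `r` prime factors and `p` is prime. As
`m` has at most `r + 1` such factorizations, Chebyshev's lower bound for `π(M / d)` gives at least
`(M / log M) / (r + 1)` times a constant times `∑ 1 / d`, and iterating the same double counting gives
`∑ 1 / d ≥ P ^ r / r!` with `P = ∑_{p ≤ N} 1 / p ≥ log log N - 1`. Since `N = exp (n ^ σ)` is allowed
for every `σ < 1`, `P` is as close to `log n` as desired, and Stirling's bound for `r!` yields the
proportion `n ^ (-(1 - a + a log a) - o(1))`. Requiring this of each of the `k` coordinates gives the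
exponent `k (1 - a + a log a) = I(c)`.
-/

/-! ### The mean value of `z ^ Ω` -/

/-- The completely multiplicative function `n ↦ z ^ Ω(n)`, extended by `0` at `0` so that it is a
morphism of monoids with zero. -/
noncomputable def powOmegaHom (z : ℝ) : ℕ →*₀ ℝ where
  toFun n := if n = 0 then 0 else z ^ Ω n
  map_zero' := by simp
  map_one' := by simp
  map_mul' m n := by
    by_cases hm : m = 0
    · simp [hm]
    by_cases hn : n = 0
    · simp [hn]
    simp [hm, hn, ArithmeticFunction.cardFactors_mul hm hn, pow_add]

lemma powOmegaHom_apply {z : ℝ} {n : ℕ} (hn : n ≠ 0) : powOmegaHom z n = z ^ Ω n := by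
  simp [powOmegaHom, hn]

lemma powOmegaHom_nonneg {z : ℝ} (hz : 0 ≤ z) (n : ℕ) : 0 ≤ powOmegaHom z n := by
  rcases eq_or_ne n 0 with rfl | hn
  · simp
  · rw [powOmegaHom_apply hn]; positivity

lemma powOmegaHom_le_one {z : ℝ} (hz : 0 ≤ z) (hz1 : z ≤ 1) (n : ℕ) : powOmegaHom z n ≤ 1 := by
  rcases eq_or_ne n 0 with rfl | hn
  · simp
  · rw [powOmegaHom_apply hn]; exact pow_le_one₀ hz hz1

/-- The completely multiplicative function `n ↦ n ^ (-s)` for `s ≠ 0`. -/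
noncomputable def rpowNegHom (s : ℝ) (hs : s ≠ 0) : ℕ →*₀ ℝ where
  toFun n := (n : ℝ) ^ (-s)
  map_zero' := by simp [Real.zero_rpow (neg_ne_zero.mpr hs)]
  map_one' := by simp
  map_mul' m n := by
    push_cast
    exact Real.mul_rpow (Nat.cast_nonneg m) (Nat.cast_nonneg n)

lemma tsum_rpow_neg_le {s : ℝ} (hs : 1 < s) :
    ∑' n : ℕ, (n : ℝ) ^ (-s) ≤ 1 + 1 / (s - 1) := by
  have hsum : Summable fun n : ℕ => (n : ℝ) ^ (-s) := Real.summable_nat_rpow.mpr (by linarith)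
  have h := ZetaAsymptotics.zeta_limit_aux1 hs
  have h0 : 0 ≤ ZetaAsymptotics.termTSum s :=
    tsum_nonneg fun n => ZetaAsymptotics.term_nonneg (n + 1) s
  rw [hsum.tsum_eq_zero_add]
  have e : ∑' n : ℕ, ((n + 1 : ℕ) : ℝ) ^ (-s) = ∑' n : ℕ, 1 / (n + 1 : ℝ) ^ s := by
    refine tsum_congr fun n => ?_
    rw [Real.rpow_neg (by positivity), one_div]
    push_cast
    rfl
  rw [e, Nat.cast_zero, Real.zero_rpow (by linarith)]
  have : 0 ≤ s * ZetaAsymptotics.termTSum s := mul_nonneg (by linarith) h0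
  linarith

/-- Comparison of Euler products: `∑ z ^ Ω(n) n ^ (-s) ≤ ζ(s) ^ z`. Factor by factor this is
Bernoulli's inequality `(1 - t) ^ z ≤ 1 - z t`. -/
lemma tsum_powOmegaHom_mul_rpow_le {z s : ℝ} (hz : 0 ≤ z) (hz1 : z ≤ 1) (hs : 1 < s) :
    (Summable fun n : ℕ => powOmegaHom z n * (n : ℝ) ^ (-s)) ∧
    ∑' n : ℕ, powOmegaHom z n * (n : ℝ) ^ (-s) ≤ (∑' n : ℕ, (n : ℝ) ^ (-s)) ^ z := by
  have hs0 : s ≠ 0 := by linarith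
  have hsum : Summable fun n : ℕ => (n : ℝ) ^ (-s) := Real.summable_nat_rpow.mpr (by linarith)
  have hsum' : Summable fun n : ℕ => powOmegaHom z n * (n : ℝ) ^ (-s) := by
    refine hsum.of_nonneg_of_le (fun n => mul_nonneg (powOmegaHom_nonneg hz n) (by positivity))
      fun n => mul_le_of_le_one_left (by positivity) (powOmegaHom_le_one hz hz1 n)
  refine ⟨hsum', ?_⟩
  have h1 := EulerProduct.eulerProduct_completely_multiplicative_hasProd
    (f := rpowNegHom s hs0) hsum.norm
  have h2 := EulerProduct.eulerProduct_completely_multiplicative_hasProd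
    (f := powOmegaHom z * rpowNegHom s hs0) hsum'.norm
  have h3 := (Real.continuous_rpow_const hz).continuousAt.tendsto.comp h1
  refine le_of_tendsto_of_tendsto' h2 h3 fun S => ?_
  have hlt : ∀ p : Nat.Primes, ((p : ℕ) : ℝ) ^ (-s) < 1 := fun p =>
    Real.rpow_lt_one_of_one_lt_of_neg (by exact_mod_cast p.2.one_lt) (by linarith)
  have hnn : ∀ p : Nat.Primes, 0 ≤ ((p : ℕ) : ℝ) ^ (-s) := fun p => by positivity
  change ∏ p ∈ S, (1 - powOmegaHom z p * ((p : ℕ) : ℝ) ^ (-s))⁻¹ ≤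
    (∏ p ∈ S, (1 - ((p : ℕ) : ℝ) ^ (-s))⁻¹) ^ z
  rw [← Real.finsetProd_rpow _ _ fun p _ => inv_nonneg.mpr (sub_nonneg.mpr (hlt p).le)]
  refine Finset.prod_le_prod (fun p _ => ?_) fun p _ => ?_
  · refine inv_nonneg.mpr (sub_nonneg.mpr ?_)
    exact mul_le_one₀ (powOmegaHom_le_one hz hz1 _) (hnn p) (hlt p).le
  · rw [powOmegaHom_apply p.2.ne_zero, ArithmeticFunction.cardFactors_apply_prime p.2, pow_one,
      Real.inv_rpow (sub_nonneg.mpr (hlt p).le)]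
    have hpos : 0 < 1 - ((p : ℕ) : ℝ) ^ (-s) := sub_pos.mpr (hlt p)
    refine inv_anti₀ (Real.rpow_pos_of_pos hpos _) ?_
    have := rpow_one_add_le_one_add_mul_self (s := -((p : ℕ) : ℝ) ^ (-s))
      (by linarith [hlt p]) hz hz1
    rw [← sub_eq_add_neg] at this
    linarith

/-- Rankin's trick at `s = 1 + 1 / log N` bounds the logarithmic mean of `z ^ Ω`. -/
lemma sum_powOmegaHom_div_le {z : ℝ} (hz : 0 ≤ z) (hz1 : z ≤ 1) {N : ℕ} (hN : 2 ≤ N) :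
    ∑ m ∈ Finset.Ioc 0 N, powOmegaHom z m / m ≤ Real.exp 1 * (1 + Real.log N) ^ z := by
  have hlog : 0 < Real.log N := Real.log_pos (by exact_mod_cast hN)
  set s : ℝ := 1 + 1 / Real.log N with hs_def
  have hs : 1 < s := by
    have : 0 < 1 / Real.log N := by positivity
    linarith
  obtain ⟨hsum, hle⟩ := tsum_powOmegaHom_mul_rpow_le hz hz1 hs
  have hζ : ∑' n : ℕ, (n : ℝ) ^ (-s) ≤ 1 + Real.log N := by
    have := tsum_rpow_neg_le hs
    simpa [hs_def] using this
  have hζ0 : 0 ≤ ∑' n : ℕ, (n : ℝ) ^ (-s) := tsum_nonneg fun n => by positivity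
  calc ∑ m ∈ Finset.Ioc 0 N, powOmegaHom z m / m
      ≤ ∑ m ∈ Finset.Ioc 0 N, Real.exp 1 * (powOmegaHom z m * (m : ℝ) ^ (-s)) := by
        refine Finset.sum_le_sum fun m hm => ?_
        rw [Finset.mem_Ioc] at hm
        have hm0 : (0 : ℝ) < m := by exact_mod_cast hm.1
        have hmN : Real.log m ≤ Real.log N := Real.log_le_log hm0 (by exact_mod_cast hm.2)
        rw [div_eq_mul_inv, mul_left_comm]
        refine mul_le_mul_of_nonneg_left ?_ (powOmegaHom_nonneg hz m)
        rw [← Real.rpow_neg_one, Real.rpow_def_of_pos hm0, Real.rpow_def_of_pos hm0, ← Real.exp_add]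
        refine Real.exp_le_exp.mpr ?_
        have : Real.log m * (1 / Real.log N) ≤ 1 := by
          rw [mul_one_div]; exact (div_le_one hlog).mpr hmN
        rw [hs_def]
        linarith
    _ = Real.exp 1 * ∑ m ∈ Finset.Ioc 0 N, powOmegaHom z m * (m : ℝ) ^ (-s) := by
        rw [Finset.mul_sum]
    _ ≤ Real.exp 1 * (1 + Real.log N) ^ z := by
        refine mul_le_mul_of_nonneg_left ?_ (Real.exp_nonneg 1)
        refine (hsum.sum_le_tsum _ fun n _ =>
          mul_nonneg (powOmegaHom_nonneg hz n) (by positivity)).trans (hle.trans ?_)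
        exact Real.rpow_le_rpow hζ0 hζ hz

/-- The Hall–Tenenbaum inequality for `z ^ Ω`: writing `log N = log m + log (N / m)`, the first part
is bounded by expanding `log = Λ * 1` and using Chebyshev's bound for `ψ`, the second by
`log t ≤ t`. -/
lemma sum_powOmegaHom_mul_log_le {z : ℝ} (hz : 0 ≤ z) (hz1 : z ≤ 1) (N : ℕ) :
    (∑ m ∈ Finset.Ioc 0 N, powOmegaHom z m) * Real.log N ≤
      (Real.log 4 + 5) * N * ∑ m ∈ Finset.Ioc 0 N, powOmegaHom z m / m := by
  let g : ArithmeticFunction ℝ := ⟨fun n => powOmegaHom z n, by simp⟩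
  have hg : ∀ n, g n = powOmegaHom z n := fun n => rfl
  have h1 : ∑ m ∈ Finset.Ioc 0 N, powOmegaHom z m * Real.log m ≤
      (Real.log 4 + 4) * N * ∑ m ∈ Finset.Ioc 0 N, powOmegaHom z m / m := by
    calc ∑ m ∈ Finset.Ioc 0 N, powOmegaHom z m * Real.log m
        ≤ ∑ m ∈ Finset.Ioc 0 N, (g * ArithmeticFunction.vonMangoldt) m := by
          refine Finset.sum_le_sum fun m _ => ?_
          rw [ArithmeticFunction.mul_apply, ← ArithmeticFunction.vonMangoldt_sum,
            Nat.sum_divisorsAntidiagonal' (f := fun a b => g a * ArithmeticFunction.vonMangoldt b),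
            Finset.mul_sum]
          refine Finset.sum_le_sum fun d hd => ?_
          refine mul_le_mul_of_nonneg_right ?_ ArithmeticFunction.vonMangoldt_nonneg
          rw [hg]
          conv_lhs => rw [← Nat.div_mul_cancel (Nat.dvd_of_mem_divisors hd), map_mul]
          exact mul_le_of_le_one_right (powOmegaHom_nonneg hz _) (powOmegaHom_le_one hz hz1 _)
      _ = ∑ m ∈ Finset.Ioc 0 N, powOmegaHom z m * Chebyshev.psi ((N / m : ℕ) : ℝ) := by
          rw [ArithmeticFunction.sum_Ioc_mul_eq_sum_sum]
          refine Finset.sum_congr rfl fun m _ => ?_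
          rw [hg, Chebyshev.psi, Nat.floor_natCast]
      _ ≤ ∑ m ∈ Finset.Ioc 0 N, (Real.log 4 + 4) * N * (powOmegaHom z m / m) := by
          refine Finset.sum_le_sum fun m _ => ?_
          have hpsi := Chebyshev.psi_le_const_mul_self (x := ((N / m : ℕ) : ℝ)) (by positivity)
          have h4 : 0 ≤ Real.log 4 := Real.log_nonneg (by norm_num)
          have hdiv : ((N / m : ℕ) : ℝ) ≤ N / m := Nat.cast_div_le
          calc powOmegaHom z m * Chebyshev.psi ((N / m : ℕ) : ℝ)
              ≤ powOmegaHom z m * ((Real.log 4 + 4) * (N / m)) := by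
                refine mul_le_mul_of_nonneg_left (hpsi.trans ?_) (powOmegaHom_nonneg hz m)
                exact mul_le_mul_of_nonneg_left hdiv (by linarith)
            _ = _ := by ring
      _ = _ := by rw [Finset.mul_sum]
  have h2 : ∑ m ∈ Finset.Ioc 0 N, powOmegaHom z m * (Real.log N - Real.log m) ≤
      N * ∑ m ∈ Finset.Ioc 0 N, powOmegaHom z m / m := by
    rw [Finset.mul_sum]
    refine Finset.sum_le_sum fun m hm => ?_
    rw [Finset.mem_Ioc] at hm
    have hm0 : (0 : ℝ) < m := by exact_mod_cast hm.1
    have hN0 : (0 : ℝ) < N := by exact_mod_cast hm.1.trans_le hm.2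
    rw [← Real.log_div hN0.ne' hm0.ne']
    calc powOmegaHom z m * Real.log (N / m) ≤ powOmegaHom z m * (N / m) :=
          mul_le_mul_of_nonneg_left (Real.log_le_self (by positivity)) (powOmegaHom_nonneg hz m)
      _ = _ := by ring
  have h3 : (∑ m ∈ Finset.Ioc 0 N, powOmegaHom z m) * Real.log N =
      ∑ m ∈ Finset.Ioc 0 N, powOmegaHom z m * Real.log m +
      ∑ m ∈ Finset.Ioc 0 N, powOmegaHom z m * (Real.log N - Real.log m) := by
    rw [← Finset.sum_add_distrib, Finset.sum_mul]
    exact Finset.sum_congr rfl fun m _ => by ring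
  rw [h3]
  linarith

/-- The mean value of `z ^ Ω` over `[1, N]` is `O((log N) ^ (z - 1))`. -/
lemma exists_sum_pow_cardFactors_le {z : ℝ} (hz : 0 ≤ z) (hz1 : z ≤ 1) :
    ∃ K : ℝ, 0 < K ∧ ∀ N : ℕ, 3 ≤ N →
      ∑ m ∈ Finset.Ioc 0 N, z ^ Ω m ≤ K * N * Real.log N ^ (z - 1) := by
  have h4 : 0 ≤ Real.log 4 := Real.log_nonneg (by norm_num)
  refine ⟨(Real.log 4 + 5) * (Real.exp 1 * 2 ^ z), by positivity, fun N hN => ?_⟩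
  have hN3 : (3 : ℝ) ≤ N := by exact_mod_cast hN
  have hlog : 1 ≤ Real.log N := by
    rw [Real.le_log_iff_exp_le (by linarith)]
    exact (Real.exp_one_lt_d9.le.trans (by norm_num)).trans hN3
  have e : ∑ m ∈ Finset.Ioc 0 N, z ^ Ω m = ∑ m ∈ Finset.Ioc 0 N, powOmegaHom z m :=
    Finset.sum_congr rfl fun m hm => (powOmegaHom_apply (Finset.mem_Ioc.mp hm).1.ne').symm
  have h1 := sum_powOmegaHom_mul_log_le hz hz1 N
  have h2 := sum_powOmegaHom_div_le hz hz1 (N := N) (by omega)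
  have h3 : (1 + Real.log N) ^ z ≤ 2 ^ z * Real.log N ^ z := by
    rw [← Real.mul_rpow (by norm_num) (by linarith)]
    exact Real.rpow_le_rpow (by linarith) (by linarith) hz
  rw [e, Real.rpow_sub_one (by linarith), ← mul_div_assoc, le_div_iff₀ (by linarith)]
  calc _ ≤ _ := h1
    _ ≤ (Real.log 4 + 5) * N * (Real.exp 1 * (2 ^ z * Real.log N ^ z)) := by
        gcongr
        exact h2.trans (by gcongr)
    _ = _ := by ring

/-! ### Integers with few prime factors -/

lemma card_primeFactors_le_cardFactors (m : ℕ) : m.primeFactors.card ≤ Ω m := by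
  rw [ArithmeticFunction.cardFactors_apply]
  exact List.toFinset_card_le _

/-- Double counting of factorizations `m = p d` with `p` prime: an integer with `r + 1` prime
factors has at most `r + 1` of them. -/
lemma sum_sum_mul_prime_le {r : ℕ} {D E : Finset ℕ} {A : ℕ → Finset ℕ} {h : ℕ → ℝ}
    (hh : ∀ m, 0 ≤ h m) (hA : ∀ d ∈ D, ∀ p ∈ A d, p.Prime ∧ p * d ∈ E)
    (hE : ∀ m ∈ E, Ω m = r + 1) :
    ∑ d ∈ D, ∑ p ∈ A d, h (p * d) ≤ (r + 1) * ∑ m ∈ E, h m := by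
  rw [Finset.sum_sigma' D A (fun d p => h (p * d)),
    ← Finset.sum_fiberwise_of_maps_to (t := E) (g := fun x : (_ : ℕ) × ℕ => x.2 * x.1)
      (fun x hx => (hA x.1 (Finset.mem_sigma.mp hx).1 x.2 (Finset.mem_sigma.mp hx).2).2),
    Finset.mul_sum]
  refine Finset.sum_le_sum fun m hm => ?_
  have hm0 : m ≠ 0 := by
    rintro rfl
    simpa using hE 0 hm
  rw [Finset.sum_congr rfl (g := fun _ => h m)
    (fun x hx => by rw [(Finset.mem_filter.mp hx).2]), Finset.sum_const, nsmul_eq_mul]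
  refine mul_le_mul_of_nonneg_right ?_ (hh m)
  have hcard : ((D.sigma A).filter fun x => x.2 * x.1 = m).card ≤ m.primeFactors.card := by
    refine Finset.card_le_card_of_injOn (fun x => x.2) (fun x hx => ?_) fun x hx y hy hxy => ?_
    · have hx' := Finset.mem_filter.mp hx
      obtain ⟨h1, h2⟩ := Finset.mem_sigma.mp hx'.1
      exact Nat.mem_primeFactors.mpr ⟨(hA _ h1 _ h2).1, ⟨x.1, hx'.2.symm⟩, hm0⟩
    · have hx' := Finset.mem_filter.mp hx
      have hy' := Finset.mem_filter.mp hy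
      obtain ⟨h1, h2⟩ := Finset.mem_sigma.mp hx'.1
      have hp := (hA _ h1 _ h2).1
      obtain ⟨d, p⟩ := x
      obtain ⟨d', p'⟩ := y
      obtain rfl : p = p' := hxy
      have : p * d = p * d' := hx'.2.trans hy'.2.symm
      obtain rfl := Nat.eq_of_mul_eq_mul_left hp.pos this
      rfl
  have := hcard.trans ((card_primeFactors_le_cardFactors m).trans (hE m hm).le)
  exact_mod_cast this

lemma sum_range_one_div_mul_pred_le (N : ℕ) :
    ∑ n ∈ Finset.range (N + 1), 1 / ((n : ℝ) * (n - 1)) ≤ 1 := by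
  rcases Nat.eq_zero_or_pos N with rfl | hN
  · simp
  suffices h : ∑ n ∈ Finset.range (N + 1), 1 / ((n : ℝ) * (n - 1)) ≤ 1 - 1 / N by
    have : (0 : ℝ) ≤ 1 / N := by positivity
    linarith
  induction N, hN using Nat.le_induction with
  | base => simp [Finset.sum_range_succ]
  | succ N hN ih =>
    rw [Finset.sum_range_succ]
    have hN0 : (0 : ℝ) < N := by exact_mod_cast hN
    have : 1 / (((N + 1 : ℕ) : ℝ) * (((N + 1 : ℕ) : ℝ) - 1)) = 1 / N - 1 / ((N + 1 : ℕ) : ℝ) := by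
      push_cast
      have : (N : ℝ) + 1 ≠ 0 := by positivity
      rw [add_sub_cancel_right]
      field_simp
      ring
    rw [this]
    linarith

/-- A lower bound of Mertens type, from Euler's comparison of the harmonic sum with the product
`∏ (1 - 1 / p)⁻¹`. -/
lemma log_log_le_sum_primesBelow (N : ℕ) (hN : 1 ≤ N) :
    Real.log (Real.log (N + 1)) - 1 ≤ ∑ p ∈ (N + 1).primesBelow, (p : ℝ)⁻¹ := by
  let f : ℕ →* ℝ :=
    { toFun := fun n => (n : ℝ)⁻¹
      map_one' := by simp
      map_mul' := fun m n => by push_cast; rw [mul_inv] }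
  have hf : ∀ {p : ℕ}, p.Prime → ‖f p‖ < 1 := by
    intro p hp
    change ‖(p : ℝ)⁻¹‖ < 1
    rw [norm_inv, Real.norm_natCast]
    exact inv_lt_one_of_one_lt₀ (by exact_mod_cast hp.one_lt)
  have hsum := (EulerProduct.summable_and_hasSum_smoothNumbers_prod_primesBelow_geometric hf
    (N + 1)).2
  have hharm : Real.log (N + 1) ≤ ∏ p ∈ (N + 1).primesBelow, (1 - (p : ℝ)⁻¹)⁻¹ := by
    have h1 := log_add_one_le_harmonic N
    rw [harmonic_eq_sum_Icc] at h1
    push_cast at h1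
    refine h1.trans ?_
    have hmem : ∀ d ∈ Finset.Icc 1 N, d ∈ (N + 1).smoothNumbers := fun d hd =>
      Nat.mem_smoothNumbers_of_lt (Finset.mem_Icc.mp hd).1
        (Nat.lt_succ_of_le (Finset.mem_Icc.mp hd).2)
    rw [← Finset.sum_subtype_of_mem (fun d : ℕ => (d : ℝ)⁻¹) hmem]
    exact sum_le_hasSum _ (fun d _ => inv_nonneg.mpr (Nat.cast_nonneg (d : ℕ))) hsum
  have hexp : ∏ p ∈ (N + 1).primesBelow, (1 - (p : ℝ)⁻¹)⁻¹ ≤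
      Real.exp (∑ p ∈ (N + 1).primesBelow, (p : ℝ)⁻¹ + 1) := by
    calc ∏ p ∈ (N + 1).primesBelow, (1 - (p : ℝ)⁻¹)⁻¹
        ≤ ∏ p ∈ (N + 1).primesBelow, Real.exp ((p : ℝ)⁻¹ + 1 / ((p : ℝ) * (p - 1))) := by
          refine Finset.prod_le_prod (fun p hp => ?_) fun p hp => ?_
          · have hp := Nat.prime_of_mem_primesBelow hp
            exact inv_nonneg.mpr (sub_nonneg.mpr
              (inv_le_one_of_one_le₀ (by exact_mod_cast hp.one_le)))
          · have hp := Nat.prime_of_mem_primesBelow hp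
            have h1 : (1 : ℝ) < p := by exact_mod_cast hp.one_lt
            have h0 : (0 : ℝ) < p - 1 := by linarith
            have : (1 - (p : ℝ)⁻¹)⁻¹ = ((p : ℝ)⁻¹ + 1 / ((p : ℝ) * (p - 1))) + 1 := by
              have h2 : 1 - (p : ℝ)⁻¹ = (p - 1) / p := by field_simp
              rw [h2, inv_div]
              field_simp
              ring
            rw [this]
            exact Real.add_one_le_exp _
      _ = Real.exp (∑ p ∈ (N + 1).primesBelow, (p : ℝ)⁻¹ +
            ∑ p ∈ (N + 1).primesBelow, 1 / ((p : ℝ) * (p - 1))) := by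
          rw [← Real.exp_sum, Finset.sum_add_distrib]
      _ ≤ _ := by
          refine Real.exp_le_exp.mpr (add_le_add le_rfl ?_)
          refine le_trans ?_ (sum_range_one_div_mul_pred_le N)
          refine Finset.sum_le_sum_of_subset_of_nonneg (Finset.filter_subset _ _) fun n _ _ => ?_
          rcases Nat.eq_zero_or_pos n with rfl | hn
          · simp
          · have : (1 : ℝ) ≤ n := by exact_mod_cast hn
            exact one_div_nonneg.mpr (mul_nonneg (by linarith) (by linarith))
  have hlog : 0 < Real.log (N + 1) := Real.log_pos (by
    have : (1 : ℝ) ≤ N := by exact_mod_cast hN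
    linarith)
  have := (Real.log_le_iff_le_exp hlog).mpr (hharm.trans hexp)
  linarith

/-- The integers `d ∈ [1, N ^ r]` with exactly `r` prime factors. -/
def omegaEqUpTo (N r : ℕ) : Finset ℕ := (Finset.Ioc 0 (N ^ r)).filter fun d => Ω d = r

lemma pow_div_factorial_le_sum_omegaEqUpTo (N r : ℕ) :
    (∑ p ∈ (N + 1).primesBelow, (p : ℝ)⁻¹) ^ r / r.factorial ≤
      ∑ d ∈ omegaEqUpTo N r, (d : ℝ)⁻¹ := by
  induction r with
  | zero =>
    have h1 : 1 ∈ omegaEqUpTo N 0 := by simp [omegaEqUpTo]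
    simpa using Finset.single_le_sum (f := fun d : ℕ => (d : ℝ)⁻¹) (fun d _ => by positivity) h1
  | succ r ih =>
    have key := sum_sum_mul_prime_le (r := r) (D := omegaEqUpTo N r) (E := omegaEqUpTo N (r + 1))
      (A := fun _ => (N + 1).primesBelow) (h := fun m => (m : ℝ)⁻¹)
      (fun m => by positivity) (fun d hd p hp => by
        obtain ⟨hd1, hd2⟩ := Finset.mem_filter.mp hd
        rw [Finset.mem_Ioc] at hd1
        have hp' := Nat.prime_of_mem_primesBelow hp
        have hpN : p ≤ N := Nat.lt_succ_iff.mp (Nat.lt_of_mem_primesBelow hp)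
        refine ⟨hp', Finset.mem_filter.mpr ⟨Finset.mem_Ioc.mpr ⟨Nat.mul_pos hp'.pos hd1.1, ?_⟩, ?_⟩⟩
        · rw [pow_succ, mul_comm p]
          exact Nat.mul_le_mul hd1.2 hpN
        · rw [ArithmeticFunction.cardFactors_mul hp'.ne_zero hd1.1.ne', hd2,
            ArithmeticFunction.cardFactors_apply_prime hp', add_comm])
      (fun m hm => (Finset.mem_filter.mp hm).2)
    have e : ∑ d ∈ omegaEqUpTo N r, ∑ p ∈ (N + 1).primesBelow, ((p * d : ℕ) : ℝ)⁻¹ =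
        (∑ p ∈ (N + 1).primesBelow, (p : ℝ)⁻¹) * ∑ d ∈ omegaEqUpTo N r, (d : ℝ)⁻¹ := by
      rw [Finset.sum_comm, Finset.sum_mul_sum]
      push_cast
      simp_rw [mul_inv]
    rw [e] at key
    have hP : 0 ≤ ∑ p ∈ (N + 1).primesBelow, (p : ℝ)⁻¹ :=
      Finset.sum_nonneg fun p _ => by positivity
    have hr : (0 : ℝ) < r + 1 := by positivity
    rw [Nat.factorial_succ, pow_succ, Nat.cast_mul, Nat.cast_succ, mul_comm (_ ^ r),
      mul_div_mul_comm, div_mul_eq_mul_div, div_le_iff₀ hr, mul_comm _ ((r : ℝ) + 1)]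
    exact (mul_le_mul_of_nonneg_left ih hP).trans key

lemma div_four_mul_log_le_primeCounting {x : ℝ} (hx : 8 ≤ x) :
    x / (4 * Real.log x) ≤ Nat.primeCounting ⌊x⌋₊ := by
  refine le_trans ?_ (Chebyshev.pi_ge' (by linarith))
  have hlog : 0 < Real.log x := Real.log_pos (by linarith)
  rw [← div_div]
  refine div_le_div_of_nonneg_right ?_ hlog.le
  have h2 := Real.log_two_gt_d9
  have h8 : Real.log (x + 2) ≤ (x + 2) / 8 - 1 + 3 * Real.log 2 := by
    have h := Real.log_le_sub_one_of_pos (x := (x + 2) / 8) (by linarith)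
    have e : Real.log 8 = 3 * Real.log 2 := by
      rw [show (8 : ℝ) = 2 ^ 3 by norm_num, Real.log_pow]; norm_num
    rw [Real.log_div (by linarith) (by norm_num), e] at h
    linarith
  nlinarith

/-- Integers `m ≤ M` with `r + 1` prime factors are produced as `m = p d`, where `d ≤ N ^ r ≤ √M` has
`r` prime factors and `p ≤ M / d` is a prime; Chebyshev's bound counts the primes `p`. -/
lemma div_log_mul_sum_le_card {N r M : ℕ} (h8 : 8 ≤ N ^ r) (hM : N ^ r * N ^ r ≤ M) :
    M / (4 * Real.log M) * ∑ d ∈ omegaEqUpTo N r, (d : ℝ)⁻¹ ≤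
      (r + 1) * ((Finset.Ioc 0 M).filter fun m => Ω m = r + 1).card := by
  have key := sum_sum_mul_prime_le (r := r) (D := omegaEqUpTo N r)
      (E := (Finset.Ioc 0 M).filter fun m => Ω m = r + 1)
      (A := fun d => (M / d + 1).primesBelow) (h := fun _ => (1 : ℝ))
      (fun m => zero_le_one) (fun d hd p hp => by
        obtain ⟨hd1, hd2⟩ := Finset.mem_filter.mp hd
        rw [Finset.mem_Ioc] at hd1
        have hp' := Nat.prime_of_mem_primesBelow hp
        have hpN : p ≤ M / d := Nat.lt_succ_iff.mp (Nat.lt_of_mem_primesBelow hp)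
        refine ⟨hp', Finset.mem_filter.mpr ⟨Finset.mem_Ioc.mpr ⟨Nat.mul_pos hp'.pos hd1.1, ?_⟩, ?_⟩⟩
        · exact (Nat.mul_le_mul_right d hpN).trans (Nat.div_mul_le_self M d)
        · rw [ArithmeticFunction.cardFactors_mul hp'.ne_zero hd1.1.ne', hd2,
            ArithmeticFunction.cardFactors_apply_prime hp', add_comm])
      (fun m hm => (Finset.mem_filter.mp hm).2)
  simp only [Finset.sum_const, nsmul_eq_mul, mul_one] at key
  refine le_trans ?_ key
  rw [Finset.mul_sum]
  refine Finset.sum_le_sum fun d hd => ?_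
  obtain ⟨hd1, -⟩ := Finset.mem_filter.mp hd
  rw [Finset.mem_Ioc] at hd1
  have hd0 : (0 : ℝ) < d := by exact_mod_cast hd1.1
  have hx : (8 : ℝ) ≤ (M : ℝ) / d := by
    rw [le_div_iff₀ hd0]
    exact_mod_cast (Nat.mul_le_mul h8 hd1.2).trans hM
  have h := div_four_mul_log_le_primeCounting hx
  rw [Nat.floor_div_natCast, Nat.floor_natCast, Nat.primeCounting,
    ← Nat.primesBelow_card_eq_primeCounting'] at h
  refine le_trans ?_ h
  rw [div_mul_eq_mul_div, ← div_eq_mul_inv]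
  refine div_le_div_of_nonneg_left (by linarith) ?_ ?_
  · have := Real.log_pos (x := (M : ℝ) / d) (by linarith)
    positivity
  · have hle : (M : ℝ) / d ≤ M := div_le_self (Nat.cast_nonneg M) (by exact_mod_cast hd1.1)
    have := Real.log_le_log (by linarith) hle
    linarith

/-- `r! ≤ (r + 1) ((r + 1) / e) ^ r`. -/
lemma factorial_mul_exp_le (r : ℕ) :
    (r.factorial : ℝ) * Real.exp r ≤ ((r : ℝ) + 1) ^ (r + 1) := by
  induction r with
  | zero => simp
  | succ r ih =>
    have h1 : ((r : ℝ) + 1) * Real.exp 1 * ((r : ℝ) + 1) ^ (r + 1) ≤ ((r : ℝ) + 2) ^ (r + 2) := by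
      have h := Real.add_one_le_exp (-(1 / ((r : ℝ) + 2)))
      have h2 : ((r : ℝ) + 1) / (r + 2) ≤ Real.exp (-(1 / ((r : ℝ) + 2))) := by
        refine le_trans (le_of_eq ?_) h
        field_simp
        ring
      have h3 := pow_le_pow_left₀ (by positivity) h2 (r + 2)
      rw [← Real.exp_nat_mul, div_pow, div_le_iff₀ (by positivity)] at h3
      have e : ((r + 2 : ℕ) : ℝ) * -(1 / ((r : ℝ) + 2)) = -1 := by
        push_cast
        field_simp
      rw [e, Real.exp_neg, inv_mul_eq_div, le_div_iff₀ (Real.exp_pos 1)] at h3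
      calc _ = ((r : ℝ) + 1) ^ (r + 2) * Real.exp 1 := by ring
        _ ≤ _ := h3
    rw [Nat.factorial_succ]
    push_cast
    rw [Real.exp_add]
    calc ((r : ℝ) + 1) * r.factorial * (Real.exp r * Real.exp 1)
        = ((r : ℝ) + 1) * Real.exp 1 * (r.factorial * Real.exp r) := by ring
      _ ≤ ((r : ℝ) + 1) * Real.exp 1 * ((r : ℝ) + 1) ^ (r + 1) := by gcongr
      _ ≤ _ := h1
      _ = _ := by norm_num [add_assoc]

/-! ### Large deviations of `Ω` from below -/

lemma tendsto_log_natCast : Tendsto (fun n : ℕ => Real.log n) atTop atTop :=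
  Real.tendsto_log_atTop.comp tendsto_natCast_atTop_atTop

lemma eventually_mul_log_pow_le_rpow (K : ℝ) (j : ℕ) {κ : ℝ} (hκ : 0 < κ) :
    ∀ᶠ n : ℕ in atTop, K * Real.log n ^ j ≤ (n : ℝ) ^ κ := by
  have h := (isLittleO_log_rpow_rpow_atTop (j : ℝ) hκ).def
    (show (0 : ℝ) < (|K| + 1)⁻¹ by positivity)
  filter_upwards [tendsto_natCast_atTop_atTop.eventually h, eventually_ge_atTop 1] with n hn h1
  have hlog : 0 ≤ Real.log n := Real.log_natCast_nonneg n
  rw [Real.rpow_natCast, Real.norm_of_nonneg (by positivity), Real.norm_of_nonneg (by positivity),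
    inv_mul_eq_div, le_div_iff₀ (by positivity)] at hn
  refine le_trans ?_ hn
  rw [mul_comm]
  exact mul_le_mul_of_nonneg_left ((le_abs_self K).trans (by linarith)) (by positivity)

/-- A form of `P ^ r / r! ≥ (e P / (r + 1)) ^ r / (r + 1)`. -/
lemma pow_div_factorial_ge {B P : ℝ} {r : ℕ} (hB : 0 ≤ B) (h : B * (r + 1) ≤ Real.exp 1 * P) :
    B ^ r / (r + 1) ≤ P ^ r / r.factorial := by
  have hfac := factorial_mul_exp_le r
  have hr : (0 : ℝ) < r + 1 := by positivity
  have hf : (0 : ℝ) < r.factorial := by exact_mod_cast r.factorial_pos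
  rw [div_le_div_iff₀ hr hf]
  have h1 := pow_le_pow_left₀ (by positivity) h r
  rw [mul_pow, mul_pow, ← Real.exp_nat_mul, mul_one] at h1
  have h2 : 0 < Real.exp (r : ℝ) := Real.exp_pos _
  have h3 : 0 ≤ B ^ r := by positivity
  refine le_of_mul_le_mul_right ?_ h2
  calc B ^ r * r.factorial * Real.exp r = B ^ r * (r.factorial * Real.exp r) := by ring
    _ ≤ B ^ r * ((r : ℝ) + 1) ^ (r + 1) := by gcongr
    _ = B ^ r * ((r : ℝ) + 1) ^ r * (r + 1) := by ring
    _ ≤ Real.exp r * P ^ r * (r + 1) := by gcongr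
    _ = _ := by ring

/-- Large deviations for `Ω` from below: at least a proportion `n ^ (-θ)` of the integers up to
`C ^ n` have at most `a log n` prime factors, for every `θ > 1 - a + a log a`. -/
lemma eventually_rpow_neg_mul_le_card {C a θ : ℝ} (hC : 1 < C) (ha0 : 0 < a) (ha1 : a < 1)
    (hθ : 1 - a + a * Real.log a < θ) :
    ∀ᶠ n : ℕ in atTop, (n : ℝ) ^ (-θ) * ⌊C ^ n⌋₊ ≤
      ((Finset.Ioc 0 ⌊C ^ n⌋₊).filter fun m => (Ω m : ℝ) ≤ a * Real.log n).card := by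
  -- `ρ = exp (-η)`: the sum of `1 / p` over the primes used is at least `ρ log n`.
  obtain ⟨η, hη0, hη1, hη⟩ : ∃ η : ℝ, 0 < η ∧ η ≤ 1 ∧ 1 - a + a * Real.log a + η < θ := by
    refine ⟨min 1 ((θ - (1 - a + a * Real.log a)) / 2), lt_min one_pos (by linarith),
      min_le_left _ _, ?_⟩
    have := min_le_right 1 ((θ - (1 - a + a * Real.log a)) / 2)
    linarith
  set ρ := Real.exp (-η) with hρ
  have hρ1 : ρ < 1 := by
    rw [hρ, ← Real.exp_zero]
    exact Real.exp_lt_exp.mpr (by linarith)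
  have hρ0 : 0 < ρ := Real.exp_pos _
  -- `σ` lies strictly between `ρ` and `1`; the primes `p ≤ exp (n ^ σ)` have `∑ 1 / p ≥ σ log n - 1`.
  set σ := (1 + ρ) / 2 with hσ
  have hσ0 : 0 < σ := by rw [hσ]; linarith
  have hσ1 : σ < 1 := by rw [hσ]; linarith
  set B := Real.exp (1 - η) / a with hB
  have hB0 : 0 < B := by positivity
  have hB1 : 1 ≤ B := by
    rw [hB, one_le_div ha0]
    exact ha1.le.trans (Real.one_le_exp (by linarith))
  have hlogB : Real.log B = 1 - η - Real.log a := by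
    rw [hB, Real.log_div (Real.exp_pos _).ne' ha0.ne', Real.log_exp]
  set κ := θ - 1 + a * Real.log B with hκ_def
  have hκ : 0 < κ := by
    rw [hκ_def, hlogB]
    nlinarith
  have hlogC : 0 < Real.log C := Real.log_pos hC
  filter_upwards [eventually_mul_log_pow_le_rpow (2 / Real.log C) 1 (sub_pos.mpr hσ1),
    tendsto_log_natCast.eventually_ge_atTop (1 / (σ - ρ)),
    tendsto_log_natCast.eventually_ge_atTop (2 / a),
    eventually_mul_log_pow_le_rpow (4 * Real.log C * B ^ 2) 2 hκ,
    ((tendsto_rpow_atTop hσ0).comp tendsto_natCast_atTop_atTop).eventually_ge_atTop 3,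
    eventually_ge_atTop 2] with n h1 h2 h3 h4 h5 hn
  simp only [Function.comp] at h5
  have hn0 : (0 : ℝ) < n := by exact_mod_cast (by omega : 0 < n)
  set L := Real.log n with hL
  have hσρ : 0 < σ - ρ := by rw [hσ]; linarith
  rw [div_le_iff₀ hσρ] at h2
  rw [div_le_iff₀ ha0] at h3
  rw [pow_one] at h1
  have hL0 : 0 < L := by
    by_contra h
    have : L * a ≤ 0 := mul_nonpos_of_nonpos_of_nonneg (not_lt.mp h) ha0.le
    linarith
  -- The parameters: products of `r + 1` primes, the first `r` of them at most `N`.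
  obtain ⟨r, hr⟩ : ∃ r, ⌊a * L⌋₊ = r + 1 := by
    refine Nat.exists_eq_succ_of_ne_zero (Nat.pos_iff_ne_zero.mp (Nat.floor_pos.mpr ?_))
    linarith
  have hrL : (r : ℝ) + 1 ≤ a * L := by
    have := Nat.floor_le (show 0 ≤ a * L by positivity)
    rw [hr] at this
    exact_mod_cast this
  have hrL' : a * L - 2 ≤ r := by
    have := Nat.lt_floor_add_one (a * L)
    rw [hr] at this
    push_cast at this
    linarith
  have hr1 : r ≠ 0 := by
    have : 2 ≤ ⌊a * L⌋₊ := Nat.le_floor (by push_cast; linarith)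
    omega
  have haL : a * L ≤ L := mul_le_of_le_one_left hL0.le ha1.le
  set N := ⌊Real.exp ((n : ℝ) ^ σ)⌋₊ with hN
  set M := ⌊C ^ n⌋₊ with hM
  have hN8 : 8 ≤ N := by
    refine Nat.le_floor ?_
    refine le_trans ?_ (Real.exp_le_exp.mpr h5)
    have h := Real.exp_one_gt_d9
    have e : Real.exp 3 = Real.exp 1 ^ 3 := by rw [← Real.exp_nat_mul]; norm_num
    rw [e]
    calc ((8 : ℕ) : ℝ) = 2 ^ 3 := by norm_num
      _ ≤ Real.exp 1 ^ 3 := by gcongr; linarith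
  have hNr8 : 8 ≤ N ^ r := hN8.trans (Nat.le_self_pow hr1 N)
  have hNM : N ^ r * N ^ r ≤ M := by
    refine Nat.le_floor ?_
    push_cast
    have hNe : (N : ℝ) ≤ Real.exp ((n : ℝ) ^ σ) := Nat.floor_le (Real.exp_nonneg _)
    have hCn : C ^ n = Real.exp (n * Real.log C) := by
      rw [Real.exp_nat_mul, Real.exp_log (by linarith)]
    rw [← pow_add, hCn]
    refine (pow_le_pow_left₀ (Nat.cast_nonneg N) hNe _).trans ?_
    rw [← Real.exp_nat_mul]
    refine Real.exp_le_exp.mpr ?_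
    have h1' : 2 * L ≤ (n : ℝ) ^ (1 - σ) * Real.log C := by
      rwa [div_mul_eq_mul_div, div_le_iff₀ hlogC] at h1
    calc ((r + r : ℕ) : ℝ) * (n : ℝ) ^ σ ≤ (2 * L) * (n : ℝ) ^ σ := by
          gcongr; push_cast; linarith
      _ ≤ ((n : ℝ) ^ (1 - σ) * Real.log C) * (n : ℝ) ^ σ := by gcongr
      _ = ((n : ℝ) ^ (1 - σ) * (n : ℝ) ^ σ) * Real.log C := by ring
      _ = n * Real.log C := by rw [← Real.rpow_add hn0, sub_add_cancel, Real.rpow_one]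
  set Q := ∑ p ∈ (N + 1).primesBelow, (p : ℝ)⁻¹ with hQ
  have hPL : ρ * L ≤ Q := by
    refine le_trans ?_ (log_log_le_sum_primesBelow N (by omega))
    have hlt : Real.exp ((n : ℝ) ^ σ) < N + 1 := Nat.lt_floor_add_one _
    have h6 : (n : ℝ) ^ σ ≤ Real.log (N + 1) :=
      (Real.le_log_iff_exp_le (by positivity)).mpr hlt.le
    have h7 : σ * L ≤ Real.log (Real.log (N + 1)) := by
      rw [hL, ← Real.log_rpow hn0]
      exact Real.log_le_log (by positivity) h6
    linarith
  have hBP : B * (r + 1) ≤ Real.exp 1 * Q := by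
    calc B * (r + 1) ≤ B * (a * L) := by gcongr
      _ = Real.exp 1 * (ρ * L) := by
          rw [hB, hρ, sub_eq_add_neg, Real.exp_add]
          field_simp
      _ ≤ Real.exp 1 * Q := by gcongr
  have hmain := (mul_le_mul_of_nonneg_left ((pow_div_factorial_ge hB0.le hBP).trans
    (pow_div_factorial_le_sum_omegaEqUpTo N r))
    (show 0 ≤ (M : ℝ) / (4 * Real.log M) from
      div_nonneg (Nat.cast_nonneg M)
        (mul_nonneg (by norm_num) (Real.log_natCast_nonneg M)))).trans
    (div_log_mul_sum_le_card hNr8 hNM)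
  have hM1 : 1 < M := by
    have : 8 * 8 ≤ N ^ r * N ^ r := Nat.mul_le_mul hNr8 hNr8
    omega
  have hM0 : (0 : ℝ) < M := by exact_mod_cast (by omega : 0 < M)
  have hlogM0 : 0 < Real.log M := Real.log_pos (by exact_mod_cast hM1)
  have hlogM : Real.log M ≤ n * Real.log C := by
    rw [← Real.log_pow]
    exact Real.log_le_log hM0 (Nat.floor_le (by positivity))
  -- `B ^ r ≥ B ^ (a L - 2) = n ^ (a log B) / B ^ 2`
  have hBr : (n : ℝ) ^ (a * Real.log B) ≤ B ^ r * B ^ 2 := by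
    rw [← pow_add, ← Real.rpow_natCast B]
    have e : (n : ℝ) ^ (a * Real.log B) = B ^ (a * L) := by
      rw [Real.rpow_def_of_pos hn0, Real.rpow_def_of_pos hB0, ← hL]
      congr 1
      ring
    rw [e]
    refine Real.rpow_le_rpow_of_exponent_le hB1 ?_
    push_cast
    linarith
  have hcard : ((Finset.Ioc 0 M).filter fun m => Ω m = r + 1).card ≤
      ((Finset.Ioc 0 M).filter fun m => (Ω m : ℝ) ≤ a * L).card := by
    refine Finset.card_le_card fun m hm => ?_
    obtain ⟨hm1, hm2⟩ := Finset.mem_filter.mp hm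
    refine Finset.mem_filter.mpr ⟨hm1, ?_⟩
    rw [hm2]
    exact_mod_cast hrL
  refine le_trans ?_ (Nat.cast_le.mpr hcard)
  have hr0 : (0 : ℝ) < r + 1 := by positivity
  refine le_of_mul_le_mul_left (le_trans ?_ hmain) hr0
  rw [div_mul_div_comm, le_div_iff₀ (by positivity)]
  have hsplit : (n : ℝ) ^ (a * Real.log B) = (n : ℝ) ^ (-θ) * (n : ℝ) ^ κ * n := by
    rw [← Real.rpow_add hn0, ← Real.rpow_add_one hn0.ne', hκ_def]
    congr 1
    ring
  have hnθ : 0 < (n : ℝ) ^ (-θ) := by positivity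
  have hB2 : 0 < B ^ 2 := by positivity
  refine le_of_mul_le_mul_right ?_ hB2
  calc (r + 1) * ((n : ℝ) ^ (-θ) * M) * (4 * Real.log M * (r + 1)) * B ^ 2
      ≤ L * ((n : ℝ) ^ (-θ) * M) * (4 * (n * Real.log C) * L) * B ^ 2 := by
        gcongr <;> linarith
    _ = (n : ℝ) ^ (-θ) * (4 * Real.log C * B ^ 2 * L ^ 2) * n * M := by ring
    _ ≤ (n : ℝ) ^ (-θ) * (n : ℝ) ^ κ * n * M := by gcongr
    _ = M * (n : ℝ) ^ (a * Real.log B) := by rw [hsplit]; ring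
    _ ≤ M * (B ^ r * B ^ 2) := by gcongr
    _ = M * B ^ r * B ^ 2 := by ring

/-! ### Probabilities in the integer box -/

lemma integerBox_eq_piFinset (k : ℕ) {X : ℝ} (hX : 0 ≤ X) :
    integerBox k X = (Fintype.piFinset fun _ : Fin k => Finset.Ioc 0 ⌊X⌋₊ : Finset (Fin k → ℕ)) := by
  ext v
  simp [integerBox, Nat.le_floor_iff hX, Nat.one_le_iff_ne_zero, Nat.pos_iff_ne_zero]

lemma uniformOn_finset_apply {α : Type*} [MeasurableSpace α] [MeasurableSingletonClass α]
    (F : Finset α) (hF : F.Nonempty) (p : α → Prop) [DecidablePred p] :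
    uniformOn (F : Set α) {v | p v} = ENNReal.ofReal ((F.filter p).card / F.card) := by
  have e : (F : Set α) ∩ {v | p v} = (F.filter p : Finset α) := by
    ext v
    simp
  rw [uniformOn, cond_apply F.measurableSet, e, Measure.count_apply_finset,
    Measure.count_apply_finset, ENNReal.ofReal_div_of_pos (by exact_mod_cast hF.card_pos),
    ENNReal.ofReal_natCast, ENNReal.ofReal_natCast, div_eq_mul_inv, mul_comm]

lemma cardFactors_finset_prod {ι : Type*} (s : Finset ι) (f : ι → ℕ) (h : ∀ i ∈ s, f i ≠ 0) :
    Ω (∏ i ∈ s, f i) = ∑ i ∈ s, Ω (f i) := by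
  classical
  induction s using Finset.induction_on with
  | empty => simp
  | insert a s ha ih =>
    rw [Finset.prod_insert ha, Finset.sum_insert ha, ArithmeticFunction.cardFactors_mul
      (h a (Finset.mem_insert_self a s))
      (Finset.prod_ne_zero_iff.mpr fun i hi => h i (Finset.mem_insert_of_mem hi)),
      ih fun i hi => h i (Finset.mem_insert_of_mem hi)]

/-- The vectors in `{1, …, M} ^ k` whose product has at most `t` prime factors. -/
noncomputable def boxOmegaLE (k M : ℕ) (t : ℝ) : Finset (Fin k → ℕ) :=
  (Fintype.piFinset fun _ : Fin k => Finset.Ioc 0 M).filter fun v => (Ω (∏ i, v i) : ℝ) ≤ t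

/-- Chernoff's bound for the number of prime factors of a product of independent coordinates. -/
lemma card_boxOmegaLE_mul_rpow_le (k M : ℕ) (t : ℝ) {z : ℝ} (hz : 0 < z) (hz1 : z ≤ 1) :
    (boxOmegaLE k M t).card * z ^ t ≤ (∑ m ∈ Finset.Ioc 0 M, z ^ Ω m) ^ k := by
  have e : (∑ m ∈ Finset.Ioc 0 M, z ^ Ω m) ^ k =
      ∑ v ∈ Fintype.piFinset fun _ : Fin k => Finset.Ioc 0 M, ∏ i, z ^ Ω (v i) := by
    rw [← Finset.prod_univ_sum (fun _ : Fin k => Finset.Ioc 0 M) fun _ m => z ^ Ω m]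
    simp
  rw [e, ← nsmul_eq_mul, ← Finset.sum_const]
  calc ∑ _v ∈ boxOmegaLE k M t, z ^ t ≤ ∑ v ∈ boxOmegaLE k M t, ∏ i, z ^ Ω (v i) := by
        refine Finset.sum_le_sum fun v hv => ?_
        obtain ⟨h1, h2⟩ := Finset.mem_filter.mp hv
        rw [Fintype.mem_piFinset] at h1
        rw [cardFactors_finset_prod _ _ fun i _ => (Finset.mem_Ioc.mp (h1 i)).1.ne'] at h2
        rw [Finset.prod_pow_eq_pow_sum, ← Real.rpow_natCast]
        exact Real.rpow_le_rpow_of_exponent_ge hz hz1 h2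
    _ ≤ _ := Finset.sum_le_sum_of_subset_of_nonneg (Finset.filter_subset _ _) fun v _ _ =>
        Finset.prod_nonneg fun i _ => by positivity

/-- Upper bound for the lower tail: the optimal choice in Chernoff's bound is `z = c / k`. -/
lemma exists_card_boxOmegaLE_div_le {k : ℕ} {C c : ℝ} (hC : 1 < C) (hc : 0 < c) (hck : c ≤ k) :
    ∃ K : ℝ, ∀ᶠ n : ℕ in atTop,
      ((boxOmegaLE k ⌊C ^ n⌋₊ (c * Real.log n)).card : ℝ) / (⌊C ^ n⌋₊ : ℝ) ^ k ≤
        K * (n : ℝ) ^ (-(k - c + c * Real.log (c / k))) := by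
  have hk : (0 : ℝ) < k := hc.trans_le hck
  set z := c / k with hz_def
  have hz : 0 < z := by positivity
  have hz1 : z ≤ 1 := (div_le_one hk).mpr hck
  have hkz : k * z = c := by rw [hz_def]; field_simp
  obtain ⟨K, hK, hmean⟩ := exists_sum_pow_cardFactors_le hz.le hz1
  have hlogC : 0 < Real.log C := Real.log_pos hC
  refine ⟨K ^ k * ((Real.log C / 2) ^ (z - 1)) ^ k, ?_⟩
  have hM := (tendsto_nat_floor_atTop.comp
    (tendsto_pow_atTop_atTop_of_one_lt hC)).eventually_ge_atTop 3
  filter_upwards [hM, eventually_ge_atTop 1] with n hn hn1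
  simp only [Function.comp] at hn
  have hn0 : (0 : ℝ) < n := by exact_mod_cast hn1
  set M := ⌊C ^ n⌋₊ with hM
  have hM3 : (3 : ℝ) ≤ M := by exact_mod_cast hn
  have hlog : n * (Real.log C / 2) ≤ Real.log M := by
    have h1 : C ^ n ≤ (M : ℝ) ^ 2 := by
      have : C ^ n < M + 1 := Nat.lt_floor_add_one _
      nlinarith
    have h2 := Real.log_le_log (by positivity) h1
    rw [Real.log_pow, Real.log_pow] at h2
    push_cast at h2
    linarith
  have hlog' : Real.log M ^ (z - 1) ≤ (n : ℝ) ^ (z - 1) * (Real.log C / 2) ^ (z - 1) := by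
    rw [← Real.mul_rpow (by positivity) (by positivity)]
    exact Real.rpow_le_rpow_of_nonpos (by positivity) hlog (by linarith)
  have hsum : (0 : ℝ) ≤ ∑ m ∈ Finset.Ioc 0 M, z ^ Ω m := Finset.sum_nonneg fun m _ => by positivity
  have h := (card_boxOmegaLE_mul_rpow_le k M (c * Real.log n) hz hz1).trans
    (pow_le_pow_left₀ hsum ((hmean M hn).trans (mul_le_mul_of_nonneg_left hlog' (by positivity))) k)
  have hzt : z ^ (c * Real.log n) = (n : ℝ) ^ (c * Real.log z) := by
    rw [Real.rpow_def_of_pos hz, Real.rpow_def_of_pos hn0]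
    congr 1
    ring
  have hpow : ((n : ℝ) ^ (z - 1)) ^ k =
      (n : ℝ) ^ (-(k - c + c * Real.log z)) * (n : ℝ) ^ (c * Real.log z) := by
    rw [← Real.rpow_mul_natCast hn0.le, ← Real.rpow_add hn0]
    congr 1
    linear_combination hkz
  rw [hzt] at h
  rw [div_le_iff₀ (by positivity)]
  refine le_of_mul_le_mul_right (h.trans (le_of_eq ?_)) (Real.rpow_pos_of_pos hn0 (c * Real.log z))
  rw [mul_pow, mul_pow, mul_pow, hpow]
  ring

/-- Lower bound for the lower tail: all `k` coordinates have at most `(c / k) log n` prime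
factors. -/
lemma eventually_inv_le_card_boxOmegaLE_div {k : ℕ} {C c : ℝ} (hC : 1 < C) (hc : 0 < c)
    (hck : c < k) (h : k - c + c * Real.log (c / k) < 1) :
    ∀ᶠ n : ℕ in atTop, (n : ℝ)⁻¹ ≤
      ((boxOmegaLE k ⌊C ^ n⌋₊ (c * Real.log n)).card : ℝ) / (⌊C ^ n⌋₊ : ℝ) ^ k := by
  have hk : (0 : ℝ) < k := hc.trans hck
  have hθ : 1 - c / k + c / k * Real.log (c / k) < 1 / k := by
    rw [lt_div_iff₀ hk]
    refine lt_of_eq_of_lt ?_ h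
    field_simp
  filter_upwards [eventually_rpow_neg_mul_le_card hC (div_pos hc hk) ((div_lt_one hk).mpr hck) hθ,
    eventually_ge_atTop 1] with n hn hn1
  have hn0 : (0 : ℝ) < n := by exact_mod_cast hn1
  have hM : (0 : ℝ) < ⌊C ^ n⌋₊ := by
    exact_mod_cast Nat.floor_pos.mpr (one_le_pow₀ hC.le)
  rw [le_div_iff₀ (by positivity)]
  have e : (n : ℝ)⁻¹ = ((n : ℝ) ^ (-(1 / (k : ℝ)))) ^ k := by
    rw [← Real.rpow_mul_natCast hn0.le, ← Real.rpow_neg_one]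
    congr 1
    field_simp
  rw [e, ← mul_pow]
  refine (pow_le_pow_left₀ (by positivity) hn k).trans ?_
  rw [← Nat.cast_pow]
  refine Nat.cast_le.mpr ?_
  set G := (Finset.Ioc 0 ⌊C ^ n⌋₊).filter fun m => (Ω m : ℝ) ≤ c / k * Real.log n
  have hG : G.card ^ k = (Fintype.piFinset fun _ : Fin k => G).card := by
    simp
  rw [hG]
  refine Finset.card_le_card fun v hv => ?_
  rw [Fintype.mem_piFinset] at hv
  have hv1 := fun i => (Finset.mem_filter.mp (hv i)).1
  refine Finset.mem_filter.mpr ⟨Fintype.mem_piFinset.mpr hv1, ?_⟩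
  rw [cardFactors_finset_prod _ _ fun i _ => (Finset.mem_Ioc.mp (hv1 i)).1.ne']
  push_cast
  calc ∑ i, (Ω (v i) : ℝ) ≤ ∑ _i : Fin k, c / k * Real.log n :=
        Finset.sum_le_sum fun i _ => (Finset.mem_filter.mp (hv i)).2
    _ = c * Real.log n := by
        simp
        field_simp

/-! ### The equation for `β` -/

/-- The function `c (1 - log c + log k)` defining `β`, in terms of `negMulLog c = - c log c`. -/
lemma mul_one_sub_log_add_log_eq (k : ℕ) (c : ℝ) :
    c * (1 - Real.log c + Real.log k) = c * (1 + Real.log k) + Real.negMulLog c := by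
  rw [Real.negMulLog]
  ring

lemma continuous_mul_one_sub_log (k : ℕ) :
    Continuous fun c : ℝ => c * (1 - Real.log c + Real.log k) := by
  simp_rw [mul_one_sub_log_add_log_eq]
  have := Real.continuous_negMulLog
  fun_prop

lemma strictMonoOn_mul_one_sub_log (k : ℕ) :
    StrictMonoOn (fun c : ℝ => c * (1 - Real.log c + Real.log k)) (Set.Icc 0 k) := by
  refine strictMonoOn_of_deriv_pos (convex_Icc _ _) (continuous_mul_one_sub_log k).continuousOn
    fun c hc => ?_
  rw [interior_Icc] at hc
  simp_rw [mul_one_sub_log_add_log_eq]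
  have h : HasDerivAt (fun c : ℝ => c * (1 + Real.log k) + Real.negMulLog c)
      (1 * (1 + Real.log k) + (-Real.log c - 1)) c :=
    ((hasDerivAt_id c).mul_const _).add (Real.hasDerivAt_negMulLog hc.1.ne')
  rw [h.deriv]
  have := Real.log_lt_log hc.1 hc.2
  linarith

lemma existsUnique_isBeta {k : ℕ} (hk : 1 ≤ k) : ∃! β : ℝ, IsBeta k β := by
  have hk1 : (1 : ℝ) ≤ k := by exact_mod_cast hk
  have hsub : Set.Icc (0 : ℝ) (k - 1) ⊆ Set.Icc 0 k := Set.Icc_subset_Icc_right (by linarith)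
  have hlog : Real.log ((k : ℝ) - 1) ≤ Real.log k := by
    rcases hk1.eq_or_lt with h | h
    · simp [← h]
    · exact Real.log_le_log (by linarith) (by linarith)
  have hivt := intermediate_value_Icc (show (0 : ℝ) ≤ k - 1 by linarith)
    (continuous_mul_one_sub_log k).continuousOn
  obtain ⟨β, hβ, hβ'⟩ := hivt (show (k : ℝ) - 1 ∈ _ from ⟨by simpa using hk1, by
    have : ((k : ℝ) - 1) * 1 ≤ (k - 1) * (1 - Real.log (k - 1) + Real.log k) :=
      mul_le_mul_of_nonneg_left (by linarith) (by linarith)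
    linarith⟩)
  refine ⟨β, ⟨hβ, hβ'⟩, fun γ hγ => ?_⟩
  exact (strictMonoOn_mul_one_sub_log k).injOn (hsub hγ.1) (hsub hβ) (hγ.2.trans hβ'.symm)

lemma rate_eq {k : ℕ} {c : ℝ} (hc : 0 < c) (hk : 0 < k) :
    k - c + c * Real.log (c / k) = k - c * (1 - Real.log c + Real.log k) := by
  rw [Real.log_div hc.ne' (by positivity)]
  ring

/-- Together with `IsBeta.rate_lt_one`: the exponent `k - c + c log (c / k)` of the tail probability
crosses `1` at `c = β`. -/
lemma IsBeta.one_lt_rate {k : ℕ} {β c : ℝ} (hβ : IsBeta k β) (hc : 0 < c) (hcβ : c < β) :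
    1 < k - c + c * Real.log (c / k) := by
  have hβk := hβ.1.2
  have hk : (0 : ℝ) < k := by linarith
  rw [rate_eq hc (by exact_mod_cast hk)]
  have := strictMonoOn_mul_one_sub_log k (a := c) ⟨hc.le, by linarith⟩ (b := β)
    ⟨hβ.1.1, by linarith⟩ hcβ
  have h2 := hβ.2
  simp only at this
  linarith

lemma IsBeta.rate_lt_one {k : ℕ} {β c : ℝ} (hβ : IsBeta k β) (hcβ : β < c) (hck : c ≤ k) :
    k - c + c * Real.log (c / k) < 1 := by
  have hc : 0 < c := hβ.1.1.trans_lt hcβ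
  have hk : (0 : ℝ) < k := hc.trans_le hck
  rw [rate_eq hc (by exact_mod_cast hk)]
  have := strictMonoOn_mul_one_sub_log k (a := β) ⟨hβ.1.1, by linarith⟩ (b := c)
    ⟨hc.le, hck⟩ hcβ
  have h2 := hβ.2
  simp only at this
  linarith

/-! ### The Borel–Cantelli argument -/

section BorelCantelli

variable {k : ℕ} {C c : ℝ} {S : Type*} [MeasurableSpace S] {P : Measure S}
  {x : ℕ → S → Fin k → ℕ}

lemma measure_cardFactors_le_eq {n : ℕ} (hC : 1 ≤ C) (hx : Measurable (x n))
    (hunif : P.map (x n) = uniformOn (integerBox k (C ^ n))) (t : ℝ) :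
    P {ω | (Ω (∏ i, x n ω i) : ℝ) ≤ t} =
      ENNReal.ofReal ((boxOmegaLE k ⌊C ^ n⌋₊ t).card / (⌊C ^ n⌋₊ : ℝ) ^ k) := by
  have hpos : 1 ≤ ⌊C ^ n⌋₊ := Nat.floor_pos.mpr (one_le_pow₀ hC)
  have h1 : P {ω | (Ω (∏ i, x n ω i) : ℝ) ≤ t} = P.map (x n) {v | (Ω (∏ i, v i) : ℝ) ≤ t} := by
    rw [Measure.map_apply hx (Set.to_countable _).measurableSet]
    rfl
  have hne : (Fintype.piFinset fun _ : Fin k => Finset.Ioc 0 ⌊C ^ n⌋₊).Nonempty :=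
    ⟨fun _ => 1, Fintype.mem_piFinset.mpr fun _ => Finset.mem_Ioc.mpr ⟨one_pos, hpos⟩⟩
  rw [h1, hunif, integerBox_eq_piFinset k (by positivity), uniformOn_finset_apply _ hne]
  congr 2
  simp

/-- First Borel–Cantelli lemma. No hypothesis concerns `x 0`, whose event may be non-measurable; it
contributes a single finite term. -/
lemma ae_eventually_lt_cardFactors [IsProbabilityMeasure P] (hC : 1 < C) (hc : 0 < c) (hck : c ≤ k)
    (hrate : 1 < k - c + c * Real.log (c / k)) (hx : ∀ n, 1 ≤ n → Measurable (x n))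
    (hunif : ∀ n, 1 ≤ n → P.map (x n) = uniformOn (integerBox k (C ^ n))) :
    ∀ᵐ ω ∂P, ∀ᶠ n : ℕ in atTop, c * Real.log n < Ω (∏ i, x n ω i) := by
  obtain ⟨K, hK⟩ := exists_card_boxOmegaLE_div_le hC hc hck
  have hsum : Summable fun n : ℕ => P.real {ω | (Ω (∏ i, x n ω i) : ℝ) ≤ c * Real.log n} := by
    refine Summable.of_norm_bounded_eventually_nat
      (g := fun n : ℕ => K * (n : ℝ) ^ (-(k - c + c * Real.log (c / k))))
      ((Real.summable_nat_rpow.mpr (by linarith)).mul_left K) ?_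
    filter_upwards [hK, eventually_ge_atTop 1] with n hn hn1
    rw [Real.norm_of_nonneg measureReal_nonneg, Measure.real,
      measure_cardFactors_le_eq hC.le (hx n hn1) (hunif n hn1),
      ENNReal.toReal_ofReal (by positivity)]
    exact hn
  have hne : ∑' n : ℕ, P {ω | (Ω (∏ i, x n ω i) : ℝ) ≤ c * Real.log n} ≠ ⊤ :=
    ne_of_eq_of_ne (tsum_congr fun n => (ofReal_measureReal (μ := P)).symm) hsum.tsum_ofReal_ne_top
  filter_upwards [ae_eventually_notMem hne] with ω hω
  filter_upwards [hω] with n hn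
  exact not_le.mp hn

/-- Second Borel–Cantelli lemma, against the divergent series `∑ 1 / n`. -/
lemma ae_frequently_cardFactors_le (hC : 1 < C) (hc : 0 < c) (hck : c < k)
    (hrate : k - c + c * Real.log (c / k) < 1) (hx : ∀ n, 1 ≤ n → Measurable (x n))
    (hunif : ∀ n, 1 ≤ n → P.map (x n) = uniformOn (integerBox k (C ^ n)))
    (hind : iIndepFun (fun n : ℕ+ => x n) P) :
    ∀ᵐ ω ∂P, ∃ᶠ n : ℕ in atTop, (Ω (∏ i, x n ω i) : ℝ) ≤ c * Real.log n := by
  have : IsProbabilityMeasure P := hind.isProbabilityMeasure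
  -- The vectors are indexed from `1` on.
  let A : ℕ → Set (Fin k → ℕ) := fun n => {v | (Ω (∏ i, v i) : ℝ) ≤ c * Real.log (n + 1 : ℕ)}
  let s : ℕ → Set S := fun n => x (n + 1) ⁻¹' A n
  have hA : ∀ n, MeasurableSet (A n) := fun n => (Set.to_countable _).measurableSet
  have hs : ∀ n, MeasurableSet (s n) := fun n => hx (n + 1) (by omega) (hA n)
  have hind' : iIndepFun (fun n : ℕ => x (n + 1)) P :=
    hind.precomp (g := Nat.succPNat) Nat.succPNat_injective
  have hsind : iIndepSet s P := by
    rw [iIndepSet_iff_meas_biInter hs]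
    intro T
    exact hind'.measure_inter_preimage_eq_mul T fun n _ => hA n
  have htop : ∑' n, P (s n) = ⊤ := by
    by_contra hne
    have hsum := ENNReal.summable_toReal hne
    refine (not_summable_iff_tendsto_nat_atTop_of_nonneg fun n => by positivity).mpr
      Real.tendsto_sum_range_one_div_nat_succ_atTop ?_
    refine Summable.of_norm_bounded_eventually_nat (g := fun n => (P (s n)).toReal) hsum ?_
    have h := (tendsto_add_atTop_nat 1).eventually
      (eventually_inv_le_card_boxOmegaLE_div hC hc hck hrate)
    filter_upwards [h] with n hn
    have hP : P (s n) = _ := measure_cardFactors_le_eq hC.le (hx (n + 1) (by omega))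
      (hunif (n + 1) (by omega)) (c * Real.log (n + 1 : ℕ))
    rw [hP, ENNReal.toReal_ofReal (by positivity), Real.norm_of_nonneg (by positivity), one_div]
    exact_mod_cast hn
  have h1 := measure_limsup_eq_one hs hsind htop
  rw [← mem_ae_iff_prob_eq_one (MeasurableSet.measurableSet_limsup hs)] at h1
  filter_upwards [h1] with ω hω
  rw [mem_limsup_iff_frequently_mem] at hω
  exact (tendsto_add_atTop_nat 1).frequently hω

end BorelCantelli

theorem mainTheorem1 (k : ℕ) (hk : 1 ≤ k) :
    (∃! β : ℝ, IsBeta k β) ∧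
    ∀ β : ℝ, IsBeta k β →
      (k = 1 → β = 0) ∧ (2 ≤ k → 0 < β) ∧
      ∀ (C : ℝ), 1 < C →
      ∀ (S : Type*) [MeasurableSpace S] (P : Measure S) [IsProbabilityMeasure P]
        (x : ℕ → S → Fin k → ℕ),
        (∀ n, 1 ≤ n → Measurable (x n)) →
        (∀ n, 1 ≤ n → P.map (x n) = uniformOn (integerBox k (C ^ n))) →
        iIndepFun (fun n : ℕ+ => x n) P →
        ∀ᵐ ω ∂P,
          liminf (fun n : ℕ => (((Ω (∏ i, x n ω i) : ℝ) / Real.log n : ℝ) : EReal)) atTop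
            = (β : EReal) := by
  refine ⟨existsUnique_isBeta hk, fun β hβ => ⟨?_, ?_, ?_⟩⟩
  · rintro rfl
    exact le_antisymm (by simpa using hβ.1.2) hβ.1.1
  · intro hk2
    refine hβ.1.1.lt_of_ne ?_
    rintro rfl
    have hk2' : (2 : ℝ) ≤ k := by exact_mod_cast hk2
    have := hβ.2
    rw [zero_mul] at this
    linarith
  intro C hC S _ P _ x hx hunif hind
  have hβ0 := hβ.1.1
  have hβk := hβ.1.2
  have hj : ∀ j : ℕ, (0 : ℝ) < 1 / ((j : ℝ) + 1) := fun j => by positivity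
  have hupper : ∀ j : ℕ, ∀ᵐ ω ∂P, ∃ᶠ n : ℕ in atTop,
      (Ω (∏ i, x n ω i) : ℝ) ≤ (β + 1 / ((j : ℝ) + 1) / 2) * Real.log n := by
    intro j
    -- Halving keeps the threshold below `k`, as `β ≤ k - 1`.
    have hj1 : 1 / ((j : ℝ) + 1) ≤ 1 := (div_le_one (by positivity)).mpr (by simp)
    have := hj j
    have hlt : β + 1 / ((j : ℝ) + 1) / 2 < k := by linarith
    exact ae_frequently_cardFactors_le hC (by linarith) hlt
      (hβ.rate_lt_one (by linarith) hlt.le) hx hunif hind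
  have hlower : ∀ j : ℕ, 0 < β - 1 / ((j : ℝ) + 1) → ∀ᵐ ω ∂P, ∀ᶠ n : ℕ in atTop,
      (β - 1 / ((j : ℝ) + 1)) * Real.log n < Ω (∏ i, x n ω i) := by
    intro j hpos
    have := hj j
    exact ae_eventually_lt_cardFactors hC hpos (by linarith)
      (hβ.one_lt_rate hpos (by linarith)) hx hunif
  have hlim := tendsto_one_div_add_atTop_nhds_zero_nat (𝕜 := ℝ)
  filter_upwards [ae_all_iff.mpr hupper, ae_all_iff.mpr fun j => ae_all_iff.mpr (hlower j)]
    with ω hup hlow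
  have hlogpos : ∀ᶠ n : ℕ in atTop, 0 < Real.log n :=
    tendsto_log_natCast.eventually_gt_atTop 0
  -- The thresholds `β ± O(1 / (j + 1))` reduce the claim to countably many almost sure events.
  refine le_antisymm ?_ ?_
  · have ht : Tendsto (fun j : ℕ => ((β + 1 / ((j : ℝ) + 1) / 2 : ℝ) : EReal)) atTop
        (nhds (β : EReal)) := by
      refine (continuous_coe_real_ereal.tendsto β).comp ?_
      simpa using (hlim.div_const 2).const_add β
    refine ge_of_tendsto' ht fun j => ?_
    refine liminf_le_of_frequently_le' (((hup j).and_eventually hlogpos).mono fun n hn => ?_)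
    exact EReal.coe_le_coe_iff.mpr ((div_le_iff₀ hn.2).mpr hn.1)
  · have ht : Tendsto (fun j : ℕ => ((β - 1 / ((j : ℝ) + 1) : ℝ) : EReal)) atTop
        (nhds (β : EReal)) := by
      refine (continuous_coe_real_ereal.tendsto β).comp ?_
      simpa using hlim.const_sub β
    refine le_of_tendsto' ht fun j => ?_
    rcases le_or_gt (β - 1 / ((j : ℝ) + 1)) 0 with hle | hpos
    · refine le_liminf_of_le (by isBoundedDefault) (Eventually.of_forall fun n => ?_)
      exact EReal.coe_le_coe_iff.mpr
        (hle.trans (div_nonneg (Nat.cast_nonneg _) (Real.log_natCast_nonneg n)))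
    · refine le_liminf_of_le (by isBoundedDefault) ?_
      filter_upwards [hlow j hpos, hlogpos] with n hn hn0
      exact EReal.coe_le_coe_iff.mpr ((le_div_iff₀ hn0).mpr hn.le)
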